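/- A multiplicative lattice is a complete lattice $L$ with bottom $0$ and top $1$ which is also a commutative monoid with identity $1$ such that $a(\bigvee_\alpha b_\alpha)=\bigvee_\alpha (ab_\alpha)$ always holds. Put $(y:x)=\bigvee\{a\in L : ax\le y\}$. An element $x$ is principal if $y\wedge zx=((y:x)\wedge z)x$ and $y\vee(z:x)=((yx\vee z):x)$ for all $y,z\in L$; $L$ is generated by principal elements if each element is a join of principal elements. $L$ is a $C$-lattice if $1$ is compact, the set $L^*$ of compact elements is closed under multiplication, and every element is a join of compact elements. An element $p\ne 1$ is prime if $xy\le p$ implies $x\le p$ or $y\le p$; $L$ is a domain if $0$ is prime. $L$ is sharp if whenever $a_1a_2\le b$ in $L$ there are $b_1\ge a_1$ and $b_2\ge a_2$ in $L$ with $b=b_1b_2$. $L$ is a Prüfer lattice if every compact element is principal, and $L$ is one-dimensional if the supremum of the lengths $n$ of chains $p_0<\dots<p_n$ of prime elements is $1$. For a maximal element $m$ (that is, maximal in $L\setminus\{1\}$), let $x_m=\bigvee\{a\in L^* : as\le x \text{ for some } s\in L^*,\ s\not\le m\}$, and let $L_m=\{x_m : x\in L\}$ with the order of $L$ and the multiplication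 $(x,y)\mapsto (xy)_m$. Let $\mathbb{Z}_-$ be the set of integers $\le 0$ together with $-\infty$, with the usual order and with addition as multiplication. Let $\mathbb{R}_1$ be the set of all intervals $[r,\infty]$ and $(r,\infty]$ with $r\ge 0$ real, together with $\{\infty\}$, ordered by inclusion and with addition of intervals $A+B=\{a+b: a\in A,\ b\in B\}$ as multiplication. **Theorem.** Let $L\neq\{0,1\}$ be a sharp $C$-lattice domain generated by principal elements. Then for every maximal element $m$ of $L$, the localization $L_m$ is isomorphic, as a multiplicative lattice, to $\mathbb{Z}_-$ or to $\mathbb{R}_1$; and $L$ is a one-dimensional Prüfer lattice. -/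

import Mathlib

open scoped Pointwise

/-- A multiplicative lattice: a complete lattice with a commutative monoid structure whose
multiplication distributes over arbitrary joins and whose identity is the top element. -/
class MultiplicativeLattice (L : Type*) [CompleteLattice L] [CommMonoid L] : Prop
    extends IsQuantale L where
  one_eq_top : (1 : L) = ⊤

namespace MultiplicativeLattice

section Basic

variable {L : Type*} [CompleteLattice L] [CommMonoid L]

/-- The residual `(y : x) = ⋁ {a | a * x ≤ y}`. -/
def residual (y x : L) : L := sSup {a : L | a * x ≤ y}

/-- `x` is meet-principal if `y ∧ z x = ((y : x) ∧ z) x` for all `y`, `z`. -/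
def IsMeetPrincipal (x : L) : Prop :=
  ∀ y z : L, y ⊓ z * x = (residual y x ⊓ z) * x

/-- `x` is join-principal if `y ∨ (z : x) = ((y x ∨ z) : x)` for all `y`, `z`. -/
def IsJoinPrincipal (x : L) : Prop :=
  ∀ y z : L, y ⊔ residual z x = residual (y * x ⊔ z) x

/-- `x` is principal if it is both meet-principal and join-principal. -/
def IsPrincipal (x : L) : Prop := IsMeetPrincipal x ∧ IsJoinPrincipal x

/-- A prime element: proper, and `x y ≤ p` implies `x ≤ p` or `y ≤ p`. -/
def IsPrimeElement (p : L) : Prop :=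
  p ≠ ⊤ ∧ ∀ x y : L, x * y ≤ p → x ≤ p ∨ y ≤ p

variable (L)

/-- `L` is a lattice domain if `0` is a prime element. -/
def IsLatticeDomain : Prop := IsPrimeElement (⊥ : L)

/-- `L` is principally generated if every element is a join of principal elements. -/
def IsPrincipallyGenerated : Prop :=
  ∀ x : L, ∃ S : Set L, (∀ s ∈ S, IsPrincipal s) ∧ sSup S = x

/-- `L` is a `C`-lattice: `1` is compact, the compact elements are closed under multiplication,
and every element is a join of compact elements. -/
structure IsCLattice : Prop where
  isCompact_one : IsCompactElement (1 : L)
  isCompact_mul : ∀ x y : L, IsCompactElement x → IsCompactElement y → IsCompactElement (x * y)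
  isCompactlyGenerated : IsCompactlyGenerated L

/-- `L` is sharp: whenever `a₁ a₂ ≤ b`, there is a factorization `b = b₁ b₂` with
`a₁ ≤ b₁` and `a₂ ≤ b₂`. -/
def IsSharp : Prop :=
  ∀ a₁ a₂ b : L, a₁ * a₂ ≤ b → ∃ b₁ b₂ : L, b = b₁ * b₂ ∧ a₁ ≤ b₁ ∧ a₂ ≤ b₂

/-- `L` is a Prüfer lattice: every compact element is principal. -/
def IsPruefer : Prop := ∀ x : L, IsCompactElement x → IsPrincipal x

/-- The (Krull) dimension of `L`: the supremum of the lengths of the finite chains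
`p₀ < p₁ < ⋯ < pₙ` of prime elements. -/
noncomputable def dimension : WithBot ℕ∞ := Order.krullDim {p : L // IsPrimeElement p}

variable {L}

/-- The localization `x_p = ⋁ {a compact | a s ≤ x for some compact s with s ≰ p}`. -/
def loc (p x : L) : L :=
  sSup {a : L | IsCompactElement a ∧ ∃ s : L, IsCompactElement s ∧ ¬ s ≤ p ∧ a * s ≤ x}

/-- The localized lattice `L_p = {x_p | x ∈ L}`, with the order of `L`. -/
def LocalizationAt (p : L) : Type _ := {y : L // ∃ x : L, loc p x = y}

instance (p : L) : PartialOrder (LocalizationAt p) :=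
  inferInstanceAs (PartialOrder {y : L // ∃ x : L, loc p x = y})

/-- The multiplication of `L_p` is `(x, y) ↦ (x y)_p`. -/
instance (p : L) : Mul (LocalizationAt p) :=
  ⟨fun x y => ⟨loc p (x.1 * y.1), x.1 * y.1, rfl⟩⟩

end Basic

/-- The lattice `ℤ₋` of the integers `≤ 0` together with `-∞`, with the usual order. -/
def ZMinus : Type := {x : WithBot ℤ // x ≤ 0}

instance : PartialOrder ZMinus := inferInstanceAs (PartialOrder {x : WithBot ℤ // x ≤ 0})

/-- The multiplication of the multiplicative lattice `ℤ₋` is the usual addition. -/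
instance : Mul ZMinus := ⟨fun x y => ⟨x.1 + y.1, add_nonpos x.2 y.2⟩⟩

/-- The sets `{∞}`, `[r, ∞]` and `(r, ∞]` for real `r ≥ 0`. -/
def IsRInterval (A : Set EReal) : Prop :=
  A = {⊤} ∨ ∃ r : ℝ, 0 ≤ r ∧ (A = Set.Icc (r : EReal) ⊤ ∨ A = Set.Ioc (r : EReal) ⊤)

theorem top_add_of_pos {A : Set EReal} (hA : ∀ x ∈ A, ⊥ < x) (hne : A.Nonempty) :
    ({⊤} : Set EReal) + A = {⊤} := by
  ext x
  simp only [Set.mem_add, Set.mem_singleton_iff]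
  constructor
  · rintro ⟨a, rfl, b, hb, rfl⟩
    exact EReal.top_add_of_ne_bot (hA b hb).ne'
  · rintro rfl
    obtain ⟨b, hb⟩ := hne
    exact ⟨⊤, rfl, b, hb, EReal.top_add_of_ne_bot (hA b hb).ne'⟩

theorem Icc_add_Icc' (r s : ℝ) :
    Set.Icc (r : EReal) ⊤ + Set.Icc (s : EReal) ⊤ = Set.Icc ((r + s : ℝ) : EReal) ⊤ := by
  ext x
  simp only [Set.mem_add, Set.mem_Icc, le_top, and_true]
  constructor
  · rintro ⟨a, ha, b, hb, rfl⟩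
    rw [EReal.coe_add]; exact add_le_add ha hb
  · intro hx
    induction x with
    | bot => simp at hx
    | top => exact ⟨⊤, le_top, ⊤, le_top, rfl⟩
    | coe t =>
      have h := EReal.coe_le_coe_iff.1 hx
      exact ⟨r, le_rfl, ((t - r : ℝ) : EReal), EReal.coe_le_coe_iff.2 (by linarith), by
        rw [← EReal.coe_add]; congr 1; ring⟩

theorem Icc_add_Ioc' (r s : ℝ) :
    Set.Icc (r : EReal) ⊤ + Set.Ioc (s : EReal) ⊤ = Set.Ioc ((r + s : ℝ) : EReal) ⊤ := by
  ext x
  simp only [Set.mem_add, Set.mem_Icc, Set.mem_Ioc, le_top, and_true]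
  constructor
  · rintro ⟨a, ha, b, hb, rfl⟩
    rw [EReal.coe_add]
    exact (EReal.add_lt_add_left_coe hb r).trans_le (add_le_add_left ha b)
  · intro hx
    induction x with
    | bot => simp at hx
    | top => exact ⟨⊤, le_top, ⊤, EReal.coe_lt_top s, rfl⟩
    | coe t =>
      have h := EReal.coe_lt_coe_iff.1 hx
      exact ⟨r, le_rfl, ((t - r : ℝ) : EReal), EReal.coe_lt_coe_iff.2 (by linarith), by
        rw [← EReal.coe_add]; congr 1; ring⟩

theorem Ioc_add_Ioc' (r s : ℝ) :
    Set.Ioc (r : EReal) ⊤ + Set.Ioc (s : EReal) ⊤ = Set.Ioc ((r + s : ℝ) : EReal) ⊤ := by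
  ext x
  simp only [Set.mem_add, Set.mem_Ioc, le_top, and_true]
  constructor
  · rintro ⟨a, ha, b, hb, rfl⟩
    rw [EReal.coe_add]; exact EReal.add_lt_add ha hb
  · intro hx
    induction x with
    | bot => simp at hx
    | top => exact ⟨⊤, EReal.coe_lt_top r, ⊤, EReal.coe_lt_top s, rfl⟩
    | coe t =>
      have h := EReal.coe_lt_coe_iff.1 hx
      exact ⟨((r + (t - r - s) / 2 : ℝ) : EReal), EReal.coe_lt_coe_iff.2 (by linarith),
        ((s + (t - r - s) / 2 : ℝ) : EReal), EReal.coe_lt_coe_iff.2 (by linarith), by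
        rw [← EReal.coe_add]; congr 1; ring⟩

theorem IsRInterval.pos_nonempty {A : Set EReal} (hA : IsRInterval A) :
    (∀ x ∈ A, ⊥ < x) ∧ A.Nonempty := by
  rcases hA with rfl | ⟨r, -, rfl | rfl⟩
  · simp
  · exact ⟨fun x hx => (EReal.bot_lt_coe r).trans_le hx.1, ⊤, by simp⟩
  · exact ⟨fun x hx => (EReal.bot_lt_coe r).trans hx.1, ⊤, by simp⟩

theorem IsRInterval.add {A B : Set EReal} (hA : IsRInterval A) (hB : IsRInterval B) :
    IsRInterval (A + B) := by
  have hA' := hA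
  have hB' := hB
  rcases hA with rfl | ⟨r, hr, hA⟩
  · rw [top_add_of_pos hB.pos_nonempty.1 hB.pos_nonempty.2]; exact Or.inl rfl
  rcases hB with rfl | ⟨s, hs, hB⟩
  · rw [add_comm, top_add_of_pos hA'.pos_nonempty.1 hA'.pos_nonempty.2]; exact Or.inl rfl
  refine Or.inr ⟨r + s, add_nonneg hr hs, ?_⟩
  rcases hA with rfl | rfl <;> rcases hB with rfl | rfl
  · exact Or.inl (Icc_add_Icc' r s)
  · exact Or.inr (Icc_add_Ioc' r s)
  · right; rw [add_comm, Icc_add_Ioc', add_comm s r]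
  · exact Or.inr (Ioc_add_Ioc' r s)

/-- The lattice `ℝ₁` of the intervals `(r, ∞]` and `[r, ∞]` with `r ≥ 0` real, together with
`{∞}`, ordered by inclusion. -/
def ROne : Type := {A : Set EReal // IsRInterval A}

instance : PartialOrder ROne := inferInstanceAs (PartialOrder {A : Set EReal // IsRInterval A})

/-- The multiplication of the multiplicative lattice `ℝ₁` is the usual interval addition
`A + B = {a + b | a ∈ A, b ∈ B}`. -/
instance : Mul ROne := ⟨fun A B => ⟨A.1 + B.1, A.2.add B.2⟩⟩

end MultiplicativeLattice

/-! The engine is `exists_principal_hull`. For a nonzero principal p ≤ A, sharpness applied to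
A·(p:A) ≤ p factors p as g·(p:A) with g ≥ A. Divisors of a nonzero principal element of a domain are
principal, and g turns out to be the least principal element above A.

The Prüfer property: dividing nonzero principal x and y by the hull of x ∨ y leaves x' and y' with
(x':y') = x'. For such a pair sharpness forces x' ∨ y'² = (x' ∨ y')², and cancelling x' yields x' ∨
y' = 1. So x ∨ y is the hull itself, hence principal, and every compact element is a finite join of
principal ones.

The localizations: all hypotheses pass to L_m, where moreover 1 is the join of a set only if it
belongs to it. Comaximality then means that one of x', y' is 1, so L_m is totally ordered. The hull
of the elements below all powers of a principal p shows that the nonzero principal elements form an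
archimedean monoid, which by Hölder embeds in the reals. If the maximal element of L_m is principal,
its powers exhaust the nonzero elements and L_m is ℤ₋. Otherwise the value group is dense, hulls act
as infima so that every r ≥ 0 is a value, and L_m is ℝ₁.

The dimension: by the archimedean property in L_m, a nonzero prime below m contains every principal
element below m, so nonzero primes are maximal. -/

namespace MultiplicativeLattice

/-! ### Residuation, principal elements and primes -/

section Principal

variable {L : Type*} [CompleteLattice L] [CommMonoid L] [MultiplicativeLattice L]

theorem le_one (x : L) : x ≤ 1 := one_eq_top (L := L) ▸ le_top

theorem mul_le_left (x y : L) : x * y ≤ x := by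
  simpa using mul_le_mul' (le_refl x) (le_one y)

theorem mul_le_right (x y : L) : x * y ≤ y := by
  simpa using mul_le_mul' (le_one x) (le_refl y)

theorem le_residual {a x y : L} : a ≤ residual y x ↔ a * x ≤ y :=
  Quantale.leftMulResiduation_le_iff_mul_le

theorem residual_mul_le (y x : L) : residual y x * x ≤ y := le_residual.1 le_rfl

theorem IsMeetPrincipal.of_le {x : L}
    (h : ∀ y z w : L, w ≤ y → w ≤ z * x → w ≤ (residual y x ⊓ z) * x) : IsMeetPrincipal x :=
  fun y z => le_antisymm (h y z _ inf_le_left inf_le_right)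
    (le_inf ((mul_le_mul' inf_le_left le_rfl).trans (residual_mul_le y x))
      (mul_le_mul' inf_le_right le_rfl))

theorem IsJoinPrincipal.of_le {x : L}
    (h : ∀ y z t : L, t * x ≤ y * x ⊔ z → t ≤ y ⊔ residual z x) : IsJoinPrincipal x :=
  fun y z => le_antisymm
    (sup_le (le_residual.2 le_sup_left) (le_residual.2 ((residual_mul_le z x).trans le_sup_right)))
    (h y z _ (residual_mul_le _ _))

theorem IsPrincipal.le_of_mul_le {x : L} (hx : IsPrincipal x) {y z t : L}
    (h : t * x ≤ y * x ⊔ z) : t ≤ y ⊔ residual z x := by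
  rw [hx.2 y z]
  exact le_residual.2 h

theorem IsPrincipal.residual_mul_eq {x y : L} (hx : IsPrincipal x) (h : y ≤ x) :
    residual y x * x = y := by
  have := hx.1 y 1
  rw [one_mul, inf_eq_left.2 h, inf_eq_left.2 (le_one _)] at this
  exact this.symm

theorem isPrincipal_one : IsPrincipal (1 : L) := by
  refine ⟨IsMeetPrincipal.of_le fun y z w hy hz => ?_, IsJoinPrincipal.of_le fun y z t h => ?_⟩
  · rw [mul_one] at hz ⊢
    exact le_inf (le_residual.2 (by simpa using hy)) hz
  · rw [mul_one, mul_one] at h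
    exact h.trans (sup_le_sup_left (le_residual.2 (by simp)) _)

theorem isPrincipal_bot : IsPrincipal (⊥ : L) := by
  refine ⟨IsMeetPrincipal.of_le fun y z w hy hz => ?_, IsJoinPrincipal.of_le fun y z t h => ?_⟩
  · rw [Quantale.mul_bot] at hz ⊢
    exact hz
  · exact le_sup_of_le_right (le_residual.2 (by simp [Quantale.mul_bot]))

theorem IsPrincipal.mul {x y : L} (hx : IsPrincipal x) (hy : IsPrincipal y) :
    IsPrincipal (x * y) := by
  refine ⟨IsMeetPrincipal.of_le fun u z w hu hz => ?_, IsJoinPrincipal.of_le fun u z t h => ?_⟩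
  · have h1 : w ≤ (residual u y ⊓ z * x) * y := by
      rw [← hy.1]; exact le_inf hu (by rwa [mul_assoc])
    refine h1.trans ?_
    rw [hx.1, mul_assoc]
    refine mul_le_mul' (inf_le_inf_right _ (le_residual.2 ?_)) le_rfl
    rw [← mul_assoc]
    exact (mul_le_mul' (residual_mul_le _ _) le_rfl).trans (residual_mul_le _ _)
  · have h1 : t * x ≤ u * x ⊔ residual z y := hy.le_of_mul_le (by simpa only [mul_assoc] using h)
    refine (hx.le_of_mul_le h1).trans (sup_le_sup_left (le_residual.2 ?_) _)
    rw [← mul_assoc]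
    exact (mul_le_mul' (residual_mul_le _ _) le_rfl).trans (residual_mul_le _ _)

omit [MultiplicativeLattice L] in
theorem IsPrincipallyGenerated.le_of_forall (hgen : IsPrincipallyGenerated L) {x y : L}
    (h : ∀ p : L, IsPrincipal p → p ≤ x → p ≤ y) : x ≤ y := by
  obtain ⟨S, hS, rfl⟩ := hgen x
  exact sSup_le fun s hs => h s (hS s hs) (le_sSup hs)

omit [MultiplicativeLattice L] in
theorem IsPrincipallyGenerated.exists_principal (hgen : IsPrincipallyGenerated L) {x y : L}
    (h : ¬ x ≤ y) : ∃ p : L, IsPrincipal p ∧ p ≤ x ∧ ¬ p ≤ y := by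
  by_contra! hc
  exact h (hgen.le_of_forall hc)

theorem isPrime_of_isCoatom {m : L} (hm : IsCoatom m) : IsPrimeElement m := by
  refine ⟨hm.1, fun x y h => ?_⟩
  by_contra! hc
  have hx : m ⊔ x = 1 := by
    rw [one_eq_top]
    exact hm.2 _ (left_lt_sup.2 hc.1)
  apply hc.2
  calc y = (m ⊔ x) * y := by rw [hx, one_mul]
    _ = m * y ⊔ x * y := Quantale.sup_mul_distrib
    _ ≤ m := sup_le (mul_le_left m y) h

theorem IsPrimeElement.le_of_pow_le {p x : L} (hp : IsPrimeElement p) {n : ℕ} (h : x ^ n ≤ p) :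
    x ≤ p := by
  induction n with
  | zero =>
    rw [pow_zero, one_eq_top] at h
    exact absurd (top_le_iff.1 h) hp.1
  | succ n ih =>
    rw [pow_succ] at h
    exact (hp.2 _ _ h).elim ih id

/-! ### Cancellation and divisors of principal elements in a domain -/

section Domain

variable (hdom : IsLatticeDomain L)
include hdom

omit [MultiplicativeLattice L] in
theorem mul_ne_bot {x y : L} (hx : x ≠ ⊥) (hy : y ≠ ⊥) : x * y ≠ ⊥ := fun h =>
  (hdom.2 x y h.le).elim (fun h => hx (le_bot_iff.1 h)) fun h => hy (le_bot_iff.1 h)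

theorem pow_ne_bot {x : L} (hx : x ≠ ⊥) (n : ℕ) : x ^ n ≠ ⊥ := fun h =>
  hx (le_bot_iff.1 (hdom.le_of_pow_le h.le))

theorem IsPrincipal.cancel {x : L} (hx : IsPrincipal x) (h0 : x ≠ ⊥) {y z : L}
    (h : y * x ≤ z * x) : y ≤ z := by
  refine (hx.le_of_mul_le (z := ⊥) (h.trans le_sup_left)).trans (sup_le le_rfl ?_)
  refine (hdom.2 _ _ (residual_mul_le ⊥ x)).elim (fun h => h.trans bot_le) fun h => ?_
  exact absurd (le_bot_iff.1 h) h0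

theorem IsPrincipal.residual_mul_right {x : L} (hx : IsPrincipal x) (h0 : x ≠ ⊥) (y z : L) :
    residual (y * x) (z * x) = residual y z := by
  refine le_antisymm (le_residual.2 (hx.cancel hdom h0 ?_)) (le_residual.2 ?_)
  · rw [mul_assoc]
    exact residual_mul_le _ _
  · rw [← mul_assoc]
    exact mul_le_mul' (residual_mul_le _ _) le_rfl

/-- Since x y can be cancelled, so can y. Multiplying the conditions for x by y turns them into
those for x y, and y is then cancelled. -/
theorem IsPrincipal.of_mul_left {x y : L} (h : IsPrincipal (x * y)) (h0 : x * y ≠ ⊥) :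
    IsPrincipal x := by
  have cancel : ∀ {u v : L}, u * y ≤ v * y → u ≤ v := fun {u v} huv =>
    h.cancel hdom h0 (by
      rw [mul_comm x, ← mul_assoc, ← mul_assoc]
      exact mul_le_mul' huv le_rfl)
  have res : ∀ u : L, residual (u * y) (x * y) ≤ residual u x := fun u =>
    le_residual.2 (cancel (by rw [mul_assoc]; exact residual_mul_le _ _))
  refine ⟨IsMeetPrincipal.of_le fun u z w hu hz => cancel ?_,
    IsJoinPrincipal.of_le fun u z t ht => ?_⟩
  · have h1 : w * y ≤ u * y ⊓ z * (x * y) :=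
      le_inf (mul_le_mul' hu le_rfl) (by rw [← mul_assoc]; exact mul_le_mul' hz le_rfl)
    rw [h.1] at h1
    rw [mul_assoc]
    exact h1.trans (mul_le_mul' (inf_le_inf_right _ (res u)) le_rfl)
  · have h1 : t * (x * y) ≤ u * (x * y) ⊔ z * y := by
      rw [← mul_assoc, ← mul_assoc, ← Quantale.sup_mul_distrib]
      exact mul_le_mul' ht le_rfl
    exact (h.le_of_mul_le h1).trans (sup_le_sup_left (res z) _)

/-! ### Principal hulls, comaximality and the Prüfer property in sharp domains -/

variable (hsharp : IsSharp L)
include hsharp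

/-- In a sharp domain, every element above a nonzero principal element has a least principal
upper bound, a complementary divisor of that principal element. -/
theorem exists_principal_hull {p A : L} (hp : IsPrincipal p) (h0 : p ≠ ⊥) (hA : p ≤ A) :
    ∃ g : L, IsPrincipal g ∧ A ≤ g ∧ p = g * residual p A ∧
      ∀ q : L, IsPrincipal q → A ≤ q → g ≤ q := by
  -- The second factor contains (p:A) and, as b₁ ≥ A, is contained in it. The first factor is the
  -- hull.
  obtain ⟨b₁, b₂, hb, h1, h2⟩ := hsharp A (residual p A) p
    (by rw [mul_comm]; exact residual_mul_le _ _)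
  have hb₂ : b₂ = residual p A := le_antisymm (le_residual.2 (by
    rw [hb, mul_comm]; exact mul_le_mul' h1 le_rfl)) h2
  have hp' := hb ▸ hp
  have h0' := hb ▸ h0
  refine ⟨b₁, hp'.of_mul_left hdom h0', h1, hb₂ ▸ hb, fun q hq hAq => ?_⟩
  have hb2p : IsPrincipal b₂ := by
    rw [mul_comm] at hp' h0'
    exact hp'.of_mul_left hdom h0'
  have hb20 : b₂ ≠ ⊥ := by
    rintro rfl
    exact h0' Quantale.mul_bot
  refine hb2p.cancel hdom hb20 ?_
  calc b₁ * b₂ = p := hb.symm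
    _ = residual p q * q := (hq.residual_mul_eq (hA.trans hAq)).symm
    _ ≤ b₂ * q := mul_le_mul' (hb₂ ▸ le_residual.2
        ((mul_le_mul' le_rfl hAq).trans (residual_mul_le _ _))) le_rfl
    _ = q * b₂ := mul_comm _ _

/-- Two principal elements of a sharp domain with no common divisor are comaximal. -/
theorem sup_eq_one_of_coprime {x y : L} (hx : IsPrincipal x) (hx0 : x ≠ ⊥) (hy : IsPrincipal y)
    (h : residual x y = x) : x ⊔ y = 1 := by
  have h' : residual y x ≤ y := by
    refine hx.cancel hdom hx0 ?_
    have h1 : residual y x * x ≤ x ⊓ 1 * y :=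
      le_inf (mul_le_right _ _) (by rw [one_mul]; exact residual_mul_le _ _)
    rw [hy.1, h, inf_eq_left.2 (le_one x)] at h1
    rwa [mul_comm y]
  -- Both factors contain x ∨ y. Conversely b y ≤ y² ∨ x for either factor b, so cancelling y gives
  -- b ≤ y ∨ (x:y) = y ∨ x. Hence x ∨ y² = (x ∨ y)².
  obtain ⟨b₁, b₂, hb, h1, h2⟩ := hsharp (x ⊔ y) (x ⊔ y) (x ⊔ y * y) (by
    rw [Quantale.sup_mul_distrib, Quantale.mul_sup_distrib (x := y)]
    exact sup_le ((mul_le_left _ _).trans le_sup_left)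
      (sup_le ((mul_le_right _ _).trans le_sup_left) le_sup_right))
  have key : ∀ {b c : L}, x ⊔ y * y = b * c → x ⊔ y ≤ c → b ≤ x ⊔ y := by
    intro b c hbc hc
    have : b * y ≤ y * y ⊔ x := by
      rw [sup_comm, hbc]
      exact mul_le_mul' le_rfl (le_sup_right.trans hc)
    have := hy.le_of_mul_le this
    rwa [h, sup_comm] at this
  have e1 : b₁ ≤ x ⊔ y := key hb h2
  have e2 : b₂ ≤ x ⊔ y := key (by rw [hb, mul_comm]) h1
  -- Cancelling x here gives 1 ≤ (x ∨ y) ∨ (y²:x), and (y²:x) ≤ (y:x) ≤ y.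
  have h3 : 1 * x ≤ (x ⊔ y) * x ⊔ y * y := by
    calc 1 * x ≤ x ⊔ y * y := by rw [one_mul]; exact le_sup_left
      _ = b₁ * b₂ := hb
      _ ≤ (x ⊔ y) * (x ⊔ y) := mul_le_mul' e1 e2
      _ = (x ⊔ y) * x ⊔ (x * y ⊔ y * y) := by
        rw [Quantale.mul_sup_distrib, Quantale.sup_mul_distrib (x := x) (z := y)]
      _ ≤ (x ⊔ y) * x ⊔ y * y := by
        refine sup_le le_sup_left (sup_le (le_sup_of_le_left ?_) le_sup_right)
        rw [mul_comm x y]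
        exact mul_le_mul' le_sup_right le_rfl
  refine le_antisymm (le_one _) ((hx.le_of_mul_le h3).trans (sup_le le_rfl (le_sup_of_le_right ?_)))
  exact (le_residual.2 ((residual_mul_le _ _).trans (mul_le_left y y))).trans h'

/-- Two nonzero principal elements of a sharp domain are comaximal up to a principal factor. -/
theorem exists_comaximal_factors {x y : L} (hx : IsPrincipal x) (hx0 : x ≠ ⊥) (hy : IsPrincipal y)
    (hy0 : y ≠ ⊥) : ∃ g x' y' : L, IsPrincipal g ∧ x = x' * g ∧ y = y' * g ∧ x' ⊔ y' = 1 := by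
  obtain ⟨g, hg, hAg, hxg, -⟩ := exists_principal_hull hdom hsharp hx hx0 (le_sup_left (b := y))
  have hyg := hg.residual_mul_eq (le_sup_right.trans hAg)
  set y' := residual y g with hy'
  set x' := residual x (x ⊔ y) with hx'
  have hxy : residual x (x ⊔ y) = residual x y := by
    refine le_antisymm (le_residual.2 ((mul_le_mul' le_rfl le_sup_right).trans
      (residual_mul_le _ _))) (le_residual.2 ?_)
    rw [Quantale.mul_sup_distrib]
    exact sup_le (mul_le_right _ _) (residual_mul_le _ _)
  have hg0 : g ≠ ⊥ := by
    rintro rfl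
    exact hx0 (by rw [hxg, Quantale.bot_mul])
  rw [mul_comm] at hxg
  have hx'0 : x' ≠ ⊥ := by
    intro h
    exact hx0 (by rw [hxg, h, Quantale.bot_mul])
  refine ⟨g, x', y', hg, hxg, hyg.symm, sup_eq_one_of_coprime hdom hsharp
    (IsPrincipal.of_mul_left hdom (hxg ▸ hx) (hxg ▸ hx0)) hx'0
    (IsPrincipal.of_mul_left hdom (hyg.symm ▸ hy) (hyg.symm ▸ hy0)) ?_⟩
  -- Coprimality: (x':y') = (x'g:y'g) = (x:y) = (x : x ∨ y) = x'.
  rw [← hg.residual_mul_right hdom hg0, hyg, ← hxg, ← hxy]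

/-- With the common factor g removed the cofactors are comaximal, so the join is g. -/
theorem IsPrincipal.sup {x y : L} (hx : IsPrincipal x) (hy : IsPrincipal y) :
    IsPrincipal (x ⊔ y) := by
  rcases eq_or_ne x ⊥ with rfl | hx0
  · rwa [bot_sup_eq]
  rcases eq_or_ne y ⊥ with rfl | hy0
  · rwa [sup_bot_eq]
  obtain ⟨g, x', y', hg, rfl, rfl, h⟩ := exists_comaximal_factors hdom hsharp hx hx0 hy hy0
  rwa [← Quantale.sup_mul_distrib, h, one_mul]

theorem isPruefer (hgen : IsPrincipallyGenerated L) : IsPruefer L := by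
  intro c hc
  obtain ⟨S, hS, rfl⟩ := hgen c
  obtain ⟨t, ht, hle⟩ :=
    (CompleteLattice.isCompactElement_iff_exists_le_sSup_of_le_sSup _ _).1 hc S le_rfl
  rw [le_antisymm hle (Finset.sup_le fun s hs => le_sSup (ht hs))]
  exact Finset.sup_induction isPrincipal_bot (fun a ha b hb => ha.sup hdom hsharp hb)
    fun s hs => hS s (ht hs)

end Domain

/-- A directed cover D of p yields, by meet-continuity, p ≤ (⋁ (d:p)) p. Cancelling p reduces the
claim to compactness of 1. -/
theorem IsPrincipal.isCompactElement (hdom : IsLatticeDomain L) (hC : IsCLattice L) {p : L}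
    (hp : IsPrincipal p) : IsCompactElement p := by
  have := hC.isCompactlyGenerated
  rw [CompleteLattice.isCompactElement_iff_le_of_directed_sSup_le]
  intro D hne hD hle
  rcases eq_or_ne p ⊥ with rfl | h0
  · obtain ⟨d, hd⟩ := hne
    exact ⟨d, hd, bot_le⟩
  have h1 : p ≤ sSup ((fun d => residual d p) '' D) * p := by
    calc p = p ⊓ sSup D := (inf_eq_left.2 hle).symm
      _ = ⨆ d ∈ D, p ⊓ d := hD.inf_sSup_eq
      _ ≤ _ := iSup₂_le fun d hd => by
        rw [← hp.residual_mul_eq inf_le_left]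
        refine mul_le_mul' (le_sSup_of_le ⟨d, hd, rfl⟩ (le_residual.2 ?_)) le_rfl
        exact (residual_mul_le _ _).trans inf_le_right
  have h2 : 1 ≤ sSup ((fun d => residual d p) '' D) := hp.cancel hdom h0 (by rwa [one_mul])
  obtain ⟨_, ⟨d, hd, rfl⟩, h3⟩ :=
    (CompleteLattice.isCompactElement_iff_le_of_directed_sSup_le _ 1).1 hC.isCompact_one _
      (hne.image _) (by
        rintro _ ⟨a, ha, rfl⟩ _ ⟨b, hb, rfl⟩
        obtain ⟨c, hc, hac, hbc⟩ := hD a ha b hb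
        exact ⟨_, ⟨c, hc, rfl⟩, le_residual.2 ((residual_mul_le _ _).trans hac),
          le_residual.2 ((residual_mul_le _ _).trans hbc)⟩) h2
  exact ⟨d, hd, by simpa using le_residual.1 h3⟩

end Principal

/-! ### Localization at a maximal element and transfer of the hypotheses -/

section Localization

variable {L : Type*} [CompleteLattice L] [CommMonoid L] [MultiplicativeLattice L] {m : L}

omit [CommMonoid L] [MultiplicativeLattice L] in
theorem isCompactElement_sup {a b : L} (ha : IsCompactElement a) (hb : IsCompactElement b) :
    IsCompactElement (a ⊔ b) := by
  classical
  have := CompleteLattice.isCompactElement_finsetSup (α := L) (f := id) (s := {a, b})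
    (by simp [ha, hb])
  simpa using this

omit [MultiplicativeLattice L] in
theorem loc_mono (m : L) {x y : L} (h : x ≤ y) : loc m x ≤ loc m y :=
  sSup_le_sSup fun _ ⟨ha, s, hs, hsm, has⟩ => ⟨ha, s, hs, hsm, has.trans h⟩

variable (hC : IsCLattice L)
include hC

omit [MultiplicativeLattice L] in
theorem IsCLattice.le_of_forall {x y : L}
    (h : ∀ c : L, IsCompactElement c → c ≤ x → c ≤ y) : x ≤ y :=
  have := hC.isCompactlyGenerated
  le_iff_compact_le_imp.2 h

omit [MultiplicativeLattice L] in
theorem IsCLattice.exists_compact {x y : L} (h : ¬ x ≤ y) :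
    ∃ c : L, IsCompactElement c ∧ c ≤ x ∧ ¬ c ≤ y := by
  by_contra! hc
  exact h (hC.le_of_forall hc)

variable (hm : IsCoatom m)
include hm

/-- The elements admitting a denominator form a directed set, because denominators multiply and m is
prime. A compact element below their join therefore has a single denominator. -/
theorem le_loc_iff {a x : L} (ha : IsCompactElement a) :
    a ≤ loc m x ↔ ∃ s : L, IsCompactElement s ∧ ¬ s ≤ m ∧ a * s ≤ x := by
  refine ⟨fun h => ?_, fun h => le_sSup ⟨ha, h⟩⟩
  have hp := isPrime_of_isCoatom hm
  obtain ⟨b, ⟨-, s, hs, hsm, hbs⟩, hab⟩ :=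
    (CompleteLattice.isCompactElement_iff_le_of_directed_sSup_le _ a).1 ha
      {b : L | IsCompactElement b ∧ ∃ s : L, IsCompactElement s ∧ ¬ s ≤ m ∧ b * s ≤ x}
      ⟨⊥, fun _ _ hne _ _ _ => hne.imp fun _ h => ⟨h, bot_le⟩, 1, hC.isCompact_one, fun h1 => hm.1
        (top_le_iff.1 (one_eq_top (L := L) ▸ h1)), by simp⟩
      (by
        rintro b ⟨hb, s, hs, hsm, hbs⟩ c ⟨hc, t, ht, htm, hct⟩
        refine ⟨b ⊔ c, ⟨isCompactElement_sup hb hc, s * t, hC.isCompact_mul _ _ hs ht,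
          fun h => (hp.2 _ _ h).elim hsm htm, ?_⟩, le_sup_left, le_sup_right⟩
        rw [Quantale.sup_mul_distrib, ← mul_assoc, mul_comm s, ← mul_assoc]
        exact sup_le ((mul_le_left _ _).trans hbs) ((mul_le_left _ _).trans hct)) h
  exact ⟨s, hs, hsm, (mul_le_mul' hab le_rfl).trans hbs⟩

theorem le_loc (x : L) : x ≤ loc m x :=
  hC.le_of_forall fun c hc hcx => (le_loc_iff hC hm hc).2
    ⟨1, hC.isCompact_one, fun h1 => hm.1 (top_le_iff.1 (one_eq_top (L := L) ▸ h1)), by simpa⟩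

theorem loc_le_loc_iff {x y : L} : loc m x ≤ loc m y ↔ x ≤ loc m y := by
  refine ⟨(le_loc hC hm x).trans, fun h => hC.le_of_forall fun c hc hcx => ?_⟩
  obtain ⟨s, hs, hsm, hcs⟩ := (le_loc_iff hC hm hc).1 hcx
  obtain ⟨t, ht, htm, hct⟩ := (le_loc_iff hC hm (hC.isCompact_mul _ _ hc hs)).1 (hcs.trans h)
  refine (le_loc_iff hC hm hc).2 ⟨s * t, hC.isCompact_mul _ _ hs ht, fun h =>
    ((isPrime_of_isCoatom hm).2 _ _ h).elim hsm htm, by rwa [← mul_assoc]⟩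

theorem loc_loc (x : L) : loc m (loc m x) = loc m x :=
  le_antisymm ((loc_le_loc_iff hC hm).2 le_rfl) (le_loc hC hm _)

theorem loc_mul_loc_le (x y : L) : loc m x * loc m y ≤ loc m (x * y) := by
  conv_lhs => unfold loc
  rw [sSup_mul_distrib]
  refine iSup₂_le fun a ⟨ha, s, hs, hsm, has⟩ => ?_
  rw [mul_sSup_distrib]
  refine iSup₂_le fun b ⟨hb, t, ht, htm, hbt⟩ => ?_
  refine (le_loc_iff hC hm (hC.isCompact_mul _ _ ha hb)).2 ⟨s * t, hC.isCompact_mul _ _ hs ht,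
    fun h => ((isPrime_of_isCoatom hm).2 _ _ h).elim hsm htm, ?_⟩
  rw [mul_mul_mul_comm]
  exact mul_le_mul' has hbt

theorem loc_mul_loc (x y : L) : loc m (loc m x * loc m y) = loc m (x * y) :=
  le_antisymm ((loc_le_loc_iff hC hm).2 (loc_mul_loc_le hC hm x y))
    (loc_mono m (mul_le_mul' (le_loc hC hm x) (le_loc hC hm y)))

theorem loc_loc_mul (x y : L) : loc m (loc m x * y) = loc m (x * y) := by
  rw [← loc_mul_loc hC hm, loc_loc hC hm, loc_mul_loc hC hm]

theorem loc_mul_loc_right (x y : L) : loc m (x * loc m y) = loc m (x * y) := by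
  rw [mul_comm, loc_loc_mul hC hm, mul_comm]

theorem loc_self : loc m m = m :=
  le_antisymm (sSup_le fun _ ⟨_, _, _, hsm, has⟩ =>
    ((isPrime_of_isCoatom hm).2 _ _ has).resolve_right hsm) (le_loc hC hm m)

omit hC hm in
/-- The localization map `x ↦ x_m`. -/
def toLoc (m x : L) : LocalizationAt m := ⟨loc m x, x, rfl⟩

theorem LocalizationAt.loc_val (y : LocalizationAt m) : loc m y.1 = y.1 := by
  obtain ⟨_, x, rfl⟩ := y
  exact loc_loc hC hm x

theorem toLoc_val (y : LocalizationAt m) : toLoc m y.1 = y :=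
  Subtype.ext (y.loc_val hC hm)

/-- Localization is left adjoint to the inclusion of the localized lattice. -/
abbrev locGaloisInsertion :
    GaloisInsertion (toLoc m) (fun y : LocalizationAt m => y.1) where
  choice x _ := toLoc m x
  gc x y := by
    change loc m x ≤ y.1 ↔ x ≤ y.1
    rw [← y.loc_val hC hm]
    exact loc_le_loc_iff hC hm
  le_l_u y := (toLoc_val hC hm y).ge
  choice_eq _ _ := rfl

/-- The localized lattice is complete. -/
@[reducible]
def locCompleteLattice : CompleteLattice (LocalizationAt m) :=
  (locGaloisInsertion hC hm).liftCompleteLattice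

theorem toLoc_mul (x y : L) : toLoc m (x * y) = toLoc m x * toLoc m y :=
  Subtype.ext (loc_mul_loc hC hm x y).symm

/-- The localized lattice is a commutative monoid. -/
@[reducible]
def locCommMonoid : CommMonoid (LocalizationAt m) where
  one := toLoc m 1
  mul_assoc x y z := by
    rw [← toLoc_val hC hm x, ← toLoc_val hC hm y, ← toLoc_val hC hm z]
    simp only [← toLoc_mul hC hm, mul_assoc]
  mul_comm x y := by
    rw [← toLoc_val hC hm x, ← toLoc_val hC hm y, ← toLoc_mul hC hm, mul_comm, toLoc_mul hC hm]
  one_mul x := by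
    rw [← toLoc_val hC hm x]
    exact (toLoc_mul hC hm _ _).symm.trans (by rw [one_mul])
  mul_one x := by
    rw [← toLoc_val hC hm x]
    exact (toLoc_mul hC hm _ _).symm.trans (by rw [mul_one])

theorem locMultiplicativeLattice :
    letI := locCompleteLattice hC hm
    letI := locCommMonoid hC hm
    MultiplicativeLattice (LocalizationAt m) := by
  let := locCompleteLattice hC hm
  let := locCommMonoid hC hm
  have key : ∀ (x : LocalizationAt m) (S : Set (LocalizationAt m)),
      x * sSup S = ⨆ y ∈ S, x * y := by
    intro x S
    refine le_antisymm ?_ (iSup₂_le fun y hy => ?_)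
    · change loc m (x.1 * loc m (sSup ((fun y : LocalizationAt m => y.1) '' S))) ≤ _
      rw [loc_mul_loc_right hC hm]
      refine ((locGaloisInsertion hC hm).gc _ _).2 ?_
      rw [mul_sSup_distrib]
      refine iSup₂_le ?_
      rintro _ ⟨y, hy, rfl⟩
      refine (le_loc hC hm _).trans ?_
      exact le_iSup₂_of_le (f := fun y (_ : y ∈ S) => x * y) y hy le_rfl
    · exact loc_mono m (mul_le_mul' le_rfl (le_sSup hy : y ≤ sSup S))
  refine { mul_sSup_distrib := key, sSup_mul_distrib := fun S y => ?_, one_eq_top := ?_ }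
  · rw [mul_comm, key]
    simp only [mul_comm]
  · exact le_antisymm le_top ((locGaloisInsertion hC hm).gc.monotone_l
      (le_one (L := L) ((⊤ : LocalizationAt m).1)) |>.trans' (toLoc_val hC hm _).ge)

/-- Localization as a monoid homomorphism. -/
def toLocHom :
    letI := locCommMonoid hC hm
    L →* LocalizationAt m :=
  let := locCommMonoid hC hm
  { toFun := toLoc m
    map_one' := rfl
    map_mul' := toLoc_mul hC hm }

omit [MultiplicativeLattice L] hC hm in
theorem loc_bot (hdom : IsLatticeDomain L) : loc m (⊥ : L) = ⊥ :=
  le_bot_iff.1 <| sSup_le fun _ ⟨_, _, _, hsm, has⟩ =>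
    (hdom.2 _ _ has).resolve_right fun h => hsm (h.trans bot_le)

theorem isLatticeDomain_localizationAt (hdom : IsLatticeDomain L) :
    letI := locCompleteLattice hC hm
    letI := locCommMonoid hC hm
    IsLatticeDomain (LocalizationAt m) := by
  let := locCompleteLattice hC hm
  let := locCommMonoid hC hm
  have hb : (⊥ : LocalizationAt m).1 = ⊥ := by
    have h : (⊥ : LocalizationAt m) ≤ toLoc m ⊥ := bot_le
    exact le_bot_iff.1 (le_trans (show _ ≤ loc m ⊥ from h) (loc_bot hdom).le)
  refine ⟨fun h => ?_, fun x y h => ?_⟩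
  · have h1 : m ≤ ⊥ := by
      rw [← hb, h]
      exact (le_loc hC hm m).trans (le_top : toLoc m m ≤ ⊤)
    have h2 : (⊤ : L) ≤ ⊥ := by
      rw [← hb, h]
      exact (le_loc hC hm ⊤).trans (le_top : toLoc m ⊤ ≤ ⊤)
    exact hm.1 (top_le_iff.1 (h2.trans bot_le))
  · have h1 : x.1 * y.1 ≤ ⊥ := by
      rw [← hb]
      exact (le_loc hC hm _).trans h
    exact (hdom.2 _ _ h1).imp (fun h => h.trans bot_le) fun h => h.trans bot_le

/-- Each condition is tested on compact c: a denominator s moves it into L, where p is principal,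
and is then absorbed by localizing. -/
theorem isPrincipal_toLoc (hdom : IsLatticeDomain L) {p : L} (hp : IsPrincipal p) :
    letI := locCompleteLattice hC hm
    letI := locCommMonoid hC hm
    IsPrincipal (toLoc m p) := by
  let := locCompleteLattice hC hm
  let := locCommMonoid hC hm
  have := locMultiplicativeLattice hC hm
  have gc := (locGaloisInsertion hC hm).gc
  have res : ∀ y : LocalizationAt m, residual y.1 p ≤ (residual y (toLoc m p)).1 := by
    intro y
    rw [← gc.le_iff_le, le_residual, ← toLoc_mul hC hm, gc.le_iff_le]
    exact residual_mul_le _ _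
  refine ⟨IsMeetPrincipal.of_le fun y z w hy hz => ?_,
    IsJoinPrincipal.of_le fun y z t h => ?_⟩
  · refine hC.le_of_forall fun c hc hcw => ?_
    have hcz : c ≤ loc m (z.1 * p) := by
      rw [← loc_mul_loc_right hC hm]
      exact hcw.trans hz
    obtain ⟨s, hs, hsm, hcs⟩ := (le_loc_iff hC hm hc).1 hcz
    have h1 : c * s ≤ y.1 ⊓ z.1 * p := le_inf ((mul_le_left _ _).trans (hcw.trans hy)) hcs
    rw [hp.1] at h1
    have h2 : c ≤ loc m ((residual y.1 p ⊓ z.1) * p) := (le_loc_iff hC hm hc).2 ⟨s, hs, hsm, h1⟩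
    refine h2.trans (loc_mono m (mul_le_mul' ?_ (le_loc hC hm p)))
    rw [← gc.le_iff_le]
    refine le_inf (gc.le_iff_le.2 (inf_le_left.trans (res y))) (gc.le_iff_le.2 inf_le_right)
  · refine hC.le_of_forall fun c hc hct => ?_
    have h1 : t.1 * p ≤ loc m (y.1 * p ⊔ z.1) := by
      have h0 : y * toLoc m p ⊔ z ≤ toLoc m (y.1 * p ⊔ z.1) := by
        refine sup_le ?_ ?_
        · rw [← toLoc_val hC hm y, ← toLoc_mul hC hm, toLoc_val hC hm y]
          exact loc_mono m le_sup_left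
        · rw [← toLoc_val hC hm z, toLoc_val hC hm z]
          exact show z.1 ≤ loc m _ from le_trans (le_sup_right (a := y.1 * p)) (le_loc hC hm _)
      refine le_trans ?_ (h.trans h0)
      exact (mul_le_mul' le_rfl (le_loc hC hm p)).trans (le_loc hC hm _)
    -- A single denominator for c p exists because p, being principal, is compact.
    obtain ⟨s, hs, hsm, hcs⟩ := (le_loc_iff hC hm
      (hC.isCompact_mul _ _ hc (hp.isCompactElement hdom hC))).1
      ((mul_le_mul' hct le_rfl).trans h1)
    have h2 : c * s * p ≤ y.1 * p ⊔ z.1 := by rwa [mul_right_comm]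
    refine ((le_loc_iff hC hm hc).2 ⟨s, hs, hsm, hp.le_of_mul_le h2⟩).trans ?_
    refine gc.le_iff_le.2 (sup_le (le_sup_left : y ≤ _) ?_)
    exact (res z).trans (le_sup_right : residual z (toLoc m p) ≤ _)

theorem isPrincipallyGenerated_localizationAt (hdom : IsLatticeDomain L)
    (hgen : IsPrincipallyGenerated L) :
    letI := locCompleteLattice hC hm
    letI := locCommMonoid hC hm
    IsPrincipallyGenerated (LocalizationAt m) := by
  let := locCompleteLattice hC hm
  let := locCommMonoid hC hm
  intro x
  obtain ⟨S, hS, hx⟩ := hgen x.1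
  refine ⟨toLoc m '' S, ?_, ?_⟩
  · rintro _ ⟨p, hp, rfl⟩
    exact isPrincipal_toLoc hC hm hdom (hS p hp)
  · rw [sSup_image, ← (locGaloisInsertion hC hm).gc.l_sSup, hx, toLoc_val hC hm]

theorem isSharp_localizationAt (hsharp : IsSharp L) :
    letI := locCommMonoid hC hm
    letI := locCompleteLattice hC hm
    IsSharp (LocalizationAt m) := by
  let := locCommMonoid hC hm
  let := locCompleteLattice hC hm
  intro a₁ a₂ b h
  obtain ⟨b₁, b₂, hb, h1, h2⟩ := hsharp a₁.1 a₂.1 b.1 ((le_loc hC hm _).trans h)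
  refine ⟨toLoc m b₁, toLoc m b₂, ?_, h1.trans (le_loc hC hm _), h2.trans (le_loc hC hm _)⟩
  rw [← toLoc_mul hC hm, ← hb, toLoc_val hC hm]

/-- A join equal to 1 in L_m is not below m in L, so some member is not below m either and localizes
to 1. This is the form in which locality is used later. -/
theorem one_mem_of_sSup_eq_one_localizationAt :
    letI := locCommMonoid hC hm
    letI := locCompleteLattice hC hm
    ∀ S : Set (LocalizationAt m), sSup S = 1 → 1 ∈ S := by
  let := locCommMonoid hC hm
  let := locCompleteLattice hC hm
  intro S hS
  have h1 : (1 : L) ≤ loc m (sSup ((fun y : LocalizationAt m => y.1) '' S)) :=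
    (le_loc hC hm 1).trans (le_of_eq (congrArg Subtype.val hS.symm))
  obtain ⟨s, hs, hsm, hle⟩ := (le_loc_iff hC hm hC.isCompact_one).1 h1
  rw [one_mul] at hle
  have : ¬ sSup ((fun y : LocalizationAt m => y.1) '' S) ≤ m := fun h => hsm (hle.trans h)
  rw [sSup_le_iff] at this
  push Not at this
  obtain ⟨_, ⟨x, hx, rfl⟩, hxm⟩ := this
  obtain ⟨c, hc, hcx, hcm⟩ := hC.exists_compact hxm
  have h2 : (1 : L) ≤ loc m x.1 :=
    (le_loc_iff hC hm hC.isCompact_one).2 ⟨c, hc, hcm, by rwa [one_mul]⟩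
  have h3 : x = 1 := by
    rw [← toLoc_val hC hm x]
    exact le_antisymm (loc_mono m (le_one _)) ((loc_le_loc_iff hC hm).2 h2)
  exact h3 ▸ hx

theorem exists_ne_localizationAt (hdom : IsLatticeDomain L) (h0 : m ≠ ⊥) :
    letI := locCompleteLattice hC hm
    ∃ x : LocalizationAt m, x ≠ ⊥ ∧ x ≠ ⊤ := by
  let := locCompleteLattice hC hm
  refine ⟨toLoc m m, fun h => h0 (le_bot_iff.1 ?_), fun h => hm.1 (top_le_iff.1 ?_)⟩
  · have h1 : toLoc m m ≤ toLoc m ⊥ := h.le.trans bot_le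
    exact (le_loc hC hm m).trans (le_trans (show loc m m ≤ loc m ⊥ from h1) (loc_bot hdom).le)
  · have h1 : toLoc m ⊤ ≤ toLoc m m := le_top.trans h.ge
    exact (le_loc hC hm ⊤).trans (le_trans (show loc m ⊤ ≤ loc m m from h1) (loc_self hC hm).le)

end Localization

/-! ### Real valuations and the classification of local sharp domains -/

section Valuation

/-- Hölder's theorem for a totally ordered cancellative monoid with divisibility order. -/
theorem exists_real_valuation {P : Type*} [CommMonoid P] [LinearOrder P] [IsOrderedCancelMonoid P]
    (hdiv : ∀ p q : P, p ≤ q → ∃ r, p = q * r) (hone : ∀ p : P, p ≤ 1)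
    (harch : ∀ p q : P, p ≠ 1 → ∃ n : ℕ, p ^ n ≤ q) :
    ∃ f : P → ℝ, (∀ p q, f (p * q) = f p + f q) ∧ StrictAnti f := by
  let G := Algebra.GrothendieckGroup P
  -- For x = a/b and y = c/d > 1, write d = c r with r ≠ 1. Once rⁿ ≤ b, the fact that a ≤ 1 gives x
  -- ≤ yⁿ.
  have : MulArchimedean G := by
    refine ⟨fun x y => ?_⟩
    induction x using Localization.ind with
    | H x =>
    induction y using Localization.ind with
    | H y =>
    obtain ⟨a, b, -⟩ := x
    obtain ⟨c, d, -⟩ := y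
    intro hy
    have hdc : d < c := by
      rw [← Localization.mk_one, Localization.mk_lt_mk] at hy
      simpa using hy
    obtain ⟨r, rfl⟩ := hdiv d c hdc.le
    have hr : r ≠ 1 := by
      rintro rfl
      simp at hdc
    obtain ⟨n, hn⟩ := harch r b hr
    refine ⟨n, ?_⟩
    rw [Localization.mk_pow, Localization.mk_le_mk]
    calc (c * r) ^ n * a ≤ (c * r) ^ n * 1 := mul_le_mul_right (hone a) _
      _ = r ^ n * c ^ n := by rw [mul_one, mul_pow, mul_comm]
      _ ≤ b * c ^ n := mul_le_mul_left hn _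
  obtain ⟨e, he⟩ := Archimedean.exists_orderAddMonoidHom_real_injective (Additive G)
  let ι : P →* G := Algebra.GrothendieckGroup.of
  refine ⟨fun p => -e (Additive.ofMul (ι p)), fun p q => ?_, fun p q hpq => ?_⟩
  · simp only [map_mul, ofMul_mul, map_add]
    ring
  · have h1 : ι p < ι q := by
      change Algebra.GrothendieckGroup.of p < Algebra.GrothendieckGroup.of q
      simp only [Algebra.GrothendieckGroup.of, Submonoid.LocalizationMap.toMonoidHom_apply,
        ← Localization.mk_one_eq_monoidOf_mk, Localization.mk_lt_mk]
      simpa using hpq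
    have h2 : Additive.ofMul (ι p) < Additive.ofMul (ι q) := h1
    exact neg_lt_neg ((e.monotone'.strictMono_of_injective he) h2)

theorem nonempty_orderMonoidIso {α β : Type*} [PartialOrder α] [PartialOrder β] [Mul α] [Mul β]
    (φ : α → β) (hle : ∀ a b, φ a ≤ φ b ↔ a ≤ b) (hmul : ∀ a b, φ (a * b) = φ a * φ b)
    (hsurj : Function.Surjective φ) : Nonempty (α ≃*o β) := by
  have hinj : Function.Injective φ := fun a b h =>
    le_antisymm ((hle a b).1 h.le) ((hle b a).1 h.ge)
  exact ⟨{ MulEquiv.ofBijective (⟨φ, hmul⟩ : α →ₙ* β) ⟨hinj, hsurj⟩ with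
    map_le_map_iff' := fun {a b} => hle a b }⟩

variable {V : Type*} [CompleteLattice V] [CommMonoid V] [MultiplicativeLattice V]

/-- The nonzero principal elements of a lattice domain. -/
def principalSubmonoid (hdom : IsLatticeDomain V) : Submonoid V where
  carrier := {p | IsPrincipal p ∧ p ≠ ⊥}
  mul_mem' hp hq := ⟨hp.1.mul hq.1, mul_ne_bot hdom hp.2 hq.2⟩
  one_mem' := ⟨isPrincipal_one, fun h => hdom.1 (h.symm.trans one_eq_top)⟩

variable (hdom : IsLatticeDomain V) (hgen : IsPrincipallyGenerated V) (hsharp : IsSharp V)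
  (hloc : ∀ S : Set V, sSup S = 1 → (1 : V) ∈ S)

include hdom

theorem exists_mul_eq_of_le {p q : principalSubmonoid hdom} (h : p ≤ q) : ∃ r, p = q * r := by
  have h1 := q.2.1.residual_mul_eq (y := p.1) h
  have h2 := p.2
  rw [← h1] at h2
  refine ⟨⟨_, h2.1.of_mul_left hdom h2.2, ?_⟩, Subtype.ext ?_⟩
  · intro h
    exact h2.2 (by rw [h, Quantale.bot_mul])
  · rw [Submonoid.coe_mul, mul_comm]
    exact h1.symm

include hloc

omit hdom [MultiplicativeLattice V] in
theorem exists_maximal : ∃ μ : V, μ ≠ 1 ∧ ∀ x : V, x ≠ 1 → x ≤ μ :=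
  ⟨sSup {x | x ≠ 1}, fun h => hloc _ h rfl, fun _ hx => le_sSup hx⟩

include hgen hsharp

/-- For principal elements the comaximal cofactors have join 1, so one of them is 1 and one element
divides the other. Generation by principal elements does the rest. -/
theorem le_total_of_local (x y : V) : x ≤ y ∨ y ≤ x := by
  have key : ∀ p q : V, IsPrincipal p → IsPrincipal q → p ≤ q ∨ q ≤ p := by
    intro p q hp hq
    rcases eq_or_ne p ⊥ with rfl | hp0
    · exact Or.inl bot_le
    rcases eq_or_ne q ⊥ with rfl | hq0
    · exact Or.inr bot_le
    obtain ⟨g, p', q', -, rfl, rfl, h⟩ := exists_comaximal_factors hdom hsharp hp hp0 hq hq0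
    rw [← sSup_pair] at h
    rcases hloc _ h with rfl | rfl
    · exact Or.inr (by rw [one_mul]; exact mul_le_right _ _)
    · exact Or.inl (by rw [one_mul]; exact mul_le_right _ _)
  by_contra! hc
  obtain ⟨p, hp, hpx, hpy⟩ := hgen.exists_principal hc.1
  refine hc.2 (hgen.le_of_forall fun q hq hqy => ?_)
  exact (key p q hp hq).elim (fun h => absurd (h.trans hqy) hpy) fun h => h.trans hpx

/-- Otherwise each s in S is (s:p) p by totality. Cancelling p makes 1 the join of the (s:p), so
some (s:p) is 1. -/
theorem exists_le_of_le_sSup {p : V} (hp : IsPrincipal p) (h0 : p ≠ ⊥) {S : Set V}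
    (h : p ≤ sSup S) : ∃ s ∈ S, p ≤ s := by
  by_contra! hc
  have h1 : sSup S ≤ sSup ((fun s => residual s p) '' S) * p := sSup_le fun s hs => by
    have hsp := (le_total_of_local hdom hgen hsharp hloc p s).resolve_left (hc s hs)
    rw [← hp.residual_mul_eq hsp]
    refine mul_le_mul' (le_sSup ⟨s, hs, ?_⟩) le_rfl
    simp only
  have h2 : 1 ≤ sSup ((fun s => residual s p) '' S) :=
    hp.cancel hdom h0 (by rw [one_mul]; exact h.trans h1)
  obtain ⟨s, hs, hs1⟩ := hloc _ (le_antisymm (le_one _) h2)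
  exact hc s hs (by simpa using le_residual.1 hs1.ge)

/-- If a lies below all powers of p, let g be the hull of the join Q of all such principal elements.
These are stable under division by p, so Q ≤ p g. Minimality gives g ≤ p g, whence p = 1. -/
theorem exists_pow_le {p a : V} (hp : IsPrincipal p) (h1 : p ≠ 1) (ha : a ≠ ⊥) :
    ∃ n : ℕ, p ^ n ≤ a := by
  by_contra! hc
  have hle : ∀ n : ℕ, a ≤ p ^ n := fun n =>
    (le_total_of_local hdom hgen hsharp hloc _ _).resolve_left (hc n)
  have hp0 : p ≠ ⊥ := by
    rintro rfl
    exact hc 1 (by simp)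
  obtain ⟨b, hb, hba, hb0⟩ := hgen.exists_principal (x := a) (y := ⊥)
    fun h => ha (le_bot_iff.1 h)
  have hb0 : b ≠ ⊥ := fun h => hb0 h.le
  set Q := sSup {q : V | IsPrincipal q ∧ ∀ n : ℕ, q ≤ p ^ n} with hQ
  have hbQ : b ≤ Q := le_sSup ⟨hb, fun n => hba.trans (hle n)⟩
  obtain ⟨g, hg, hQg, -, hmin⟩ := exists_principal_hull hdom hsharp hb hb0 hbQ
  have hg0 : g ≠ ⊥ := fun h => hb0 (le_bot_iff.1 (h ▸ hbQ.trans hQg))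
  have hQp : Q ≤ p * g := by
    refine sSup_le fun q ⟨hq, hqn⟩ => ?_
    rcases eq_or_ne q ⊥ with rfl | hq0
    · exact bot_le
    have hqp := hp.residual_mul_eq (y := q) (by simpa using hqn 1)
    rw [← hqp] at hq hq0
    rw [← hqp, mul_comm]
    have hmem : residual q p ≤ Q := by
      rw [hQ]
      refine le_sSup ⟨hq.of_mul_left hdom hq0, fun n => hp.cancel hdom hp0 ?_⟩
      rw [hqp, ← pow_succ]
      exact hqn _
    exact mul_le_mul' le_rfl (hmem.trans hQg)
  have h2 : 1 * g ≤ p * g := by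
    rw [one_mul]
    exact hmin _ (hp.mul hg) hQp
  exact h1 (le_antisymm (le_one _) (hg.cancel hdom hg0 h2))

theorem nonempty_orderMonoidIso_zMinus {μ : V} (hμ1 : μ ≠ 1) (hμ : ∀ x : V, x ≠ 1 → x ≤ μ)
    (hp : IsPrincipal μ) (h0 : μ ≠ ⊥) : Nonempty (V ≃*o ZMinus) := by
  have hpow : ∀ n : ℕ, IsPrincipal (μ ^ n) := by
    intro n
    induction n with
    | zero => simpa using isPrincipal_one
    | succ n ih => simpa only [pow_succ] using ih.mul hp
  have hanti : ∀ a b : ℕ, μ ^ a ≤ μ ^ b ↔ b ≤ a := by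
    intro a b
    constructor
    · intro h
      by_contra! hab
      obtain ⟨c, rfl⟩ := Nat.exists_eq_add_of_lt hab
      rw [add_assoc, add_comm, pow_add] at h
      have h1 : 1 ≤ μ ^ (c + 1) := (hpow a).cancel hdom (pow_ne_bot hdom h0 a) (by rwa [one_mul])
      rw [pow_succ] at h1
      exact hμ1 (le_antisymm (le_one _) (h1.trans (mul_le_right _ _)))
    · intro h
      obtain ⟨c, rfl⟩ := Nat.exists_eq_add_of_le h
      rw [pow_add]
      exact mul_le_left _ _
  -- The inverse isomorphism, k ↦ μ^(-k) and -∞ ↦ 0.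
  let g : WithBot ℤ → V := WithBot.recBotCoe ⊥ fun k => μ ^ (-k).toNat
  have gbot : g ⊥ = ⊥ := rfl
  have gcoe : ∀ k : ℤ, g k = μ ^ (-k).toNat := fun _ => rfl
  suffices h : Nonempty (ZMinus ≃*o V) from h.map fun e => e.symm
  refine nonempty_orderMonoidIso (fun z : ZMinus => g z.1) ?_ ?_ ?_
  · rintro ⟨a, ha⟩ ⟨b, hb⟩
    change g a ≤ g b ↔ a ≤ b
    induction a with
    | bot => simp [gbot]
    | coe a =>
      induction b with
      | bot =>
        rw [gbot, gcoe, le_bot_iff]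
        simp [pow_ne_bot hdom h0]
      | coe b =>
        have ha' : a ≤ 0 := by exact_mod_cast ha
        have hb' : b ≤ 0 := by exact_mod_cast hb
        rw [gcoe, gcoe, hanti, WithBot.coe_le_coe]
        omega
  · rintro ⟨a, ha⟩ ⟨b, hb⟩
    change g (a + b) = g a * g b
    induction a with
    | bot => rw [WithBot.bot_add, gbot, Quantale.bot_mul]
    | coe a =>
      induction b with
      | bot => rw [WithBot.add_bot, gbot, Quantale.mul_bot]
      | coe b =>
        have ha' : a ≤ 0 := by exact_mod_cast ha
        have hb' : b ≤ 0 := by exact_mod_cast hb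
        rw [← WithBot.coe_add, gcoe, gcoe, gcoe, ← pow_add]
        congr 1
        omega
  · intro x
    rcases eq_or_ne x ⊥ with rfl | hx
    · exact ⟨⟨⊥, bot_le⟩, rfl⟩
    have hex := exists_pow_le hdom hgen hsharp hloc hp hμ1 hx
    classical
    suffices h : ∃ k : ℕ, x = μ ^ k by
      obtain ⟨k, rfl⟩ := h
      refine ⟨⟨((-k : ℤ) : WithBot ℤ), ?_⟩, ?_⟩
      · exact_mod_cast (by simp : (-k : ℤ) ≤ 0)
      · change g ((-k : ℤ) : WithBot ℤ) = _
        rw [gcoe]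
        simp
    have hn := Nat.find_spec hex
    have hmin := fun k => Nat.find_min (m := k) hex
    -- With k + 1 the least exponent such that μ^(k+1) ≤ x, totality gives x = c μ^k. Here c ≠ 1, so
    -- c ≤ μ and x ≤ μ^(k+1).
    rcases h : Nat.find hex with _ | k
    · rw [h, pow_zero] at hn
      exact ⟨0, by rw [pow_zero]; exact le_antisymm (le_one _) hn⟩
    · rw [h] at hn hmin
      have h1 := hmin k (by omega)
      have h2 := (le_total_of_local hdom hgen hsharp hloc _ _).resolve_left h1
      have h3 := (hpow k).residual_mul_eq h2
      refine ⟨k + 1, le_antisymm ?_ hn⟩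
      rw [← h3, pow_succ, mul_comm]
      refine mul_le_mul' le_rfl (hμ _ fun h4 => h1 ?_)
      rw [h4, one_mul] at h3
      exact h3.le

theorem exists_valuation : ∃ f : principalSubmonoid hdom → ℝ,
    (∀ p q, f (p * q) = f p + f q) ∧ StrictAnti f := by
  classical
  let : LinearOrder (principalSubmonoid hdom) :=
    { (inferInstance : PartialOrder (principalSubmonoid hdom)) with
      le_total := fun p q => le_total_of_local hdom hgen hsharp hloc p.1 q.1
      toDecidableLE := Classical.decRel _ }
  have : IsOrderedCancelMonoid (principalSubmonoid hdom) :=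
    { mul_le_mul_left := fun a b h c =>
        show a.1 * c.1 ≤ b.1 * c.1 from mul_le_mul' (show a.1 ≤ b.1 from h) le_rfl
      le_of_mul_le_mul_left := fun a b c h => a.2.1.cancel hdom a.2.2 (by
        rw [mul_comm b.1, mul_comm c.1]; exact h) }
  refine exists_real_valuation (fun p q h => exists_mul_eq_of_le hdom h)
    (fun p => le_one p.1) fun p q hp => ?_
  exact exists_pow_le hdom hgen hsharp hloc p.2.1 (fun h => hp (Subtype.ext h)) q.2.2

/-- If the maximal element is not principal, the valuation takes all nonnegative real values. -/
theorem valuation_surjective {μ : V} (hμ1 : μ ≠ 1) (hμ : ∀ x : V, x ≠ 1 → x ≤ μ)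
    (hp : ¬ IsPrincipal μ) {f : principalSubmonoid hdom → ℝ}
    (hf : ∀ p q, f (p * q) = f p + f q) (hanti : StrictAnti f) {r : ℝ} (hr : 0 ≤ r) :
    ∃ p, f p = r := by
  have tot := le_total_of_local hdom hgen hsharp hloc
  have hle : ∀ {p q}, f p ≤ f q → q ≤ p := by
    intro p q h
    refine (tot q.1 p.1).elim id fun h1 => ?_
    rcases h1.eq_or_lt with h2 | h2
    · exact h2.ge
    · exact absurd (hanti (show p < q from h2)) h.not_gt
  have f1 : f 1 = 0 := by
    have := hf 1 1
    rw [mul_one] at this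
    linarith
  have fnn : ∀ p, 0 ≤ f p := fun p => f1 ▸ hanti.antitone (le_one p.1)
  -- The value group. By divisibility its nonnegative members are already values.
  let H : AddSubgroup ℝ :=
    { carrier := {x | ∃ p q, x = f p - f q}
      add_mem' := by
        rintro _ _ ⟨p, q, rfl⟩ ⟨p', q', rfl⟩
        exact ⟨p * p', q * q', by rw [hf, hf]; ring⟩
      zero_mem' := ⟨1, 1, by simp⟩
      neg_mem' := by
        rintro _ ⟨p, q, rfl⟩
        exact ⟨q, p, by ring⟩ }
  have hH : ∀ x ∈ H, 0 ≤ x → ∃ p, f p = x := by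
    rintro _ ⟨p, q, rfl⟩ h
    obtain ⟨s, rfl⟩ := exists_mul_eq_of_le hdom (hle (sub_nonneg.1 h))
    exact ⟨s, by rw [hf]; ring⟩
  have hfH : ∀ p, f p ∈ H := fun p => ⟨p, 1, by rw [f1, sub_zero]⟩
  have hpos : ∀ q : principalSubmonoid hdom, q.1 ≠ 1 → 0 < f q := fun q hq =>
    f1 ▸ hanti (show q < 1 from lt_of_le_of_ne (le_one q.1) fun h => hq (congrArg Subtype.val h))
  rcases H.dense_or_cyclic with hd | ⟨a, ha⟩
  · rcases hr.eq_or_lt with rfl | hr0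
    · exact ⟨1, f1⟩
    have btw : ∀ u v : ℝ, 0 ≤ u → u < v → ∃ p, u < f p ∧ f p < v := by
      intro u v hu huv
      obtain ⟨x, hxH, hx⟩ := hd.exists_between huv
      obtain ⟨p, rfl⟩ := hH x hxH (hu.trans hx.1.le)
      exact ⟨p, hx⟩
    obtain ⟨q₀, hq₀, -⟩ := btw r (r + 1) hr (by linarith)
    -- The hull of A has value r: were its value larger, some q ≤ A would have a value strictly
    -- between. Were it smaller, some principal q ≥ A would lie strictly below the hull.
    set A := sSup {x : V | ∃ q : principalSubmonoid hdom, q.1 = x ∧ r ≤ f q} with hA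
    have hqA : ∀ q : principalSubmonoid hdom, r ≤ f q → q.1 ≤ A := fun q hq =>
      le_sSup ⟨q, rfl, hq⟩
    obtain ⟨g, hg, hAg, -, hmin⟩ :=
      exists_principal_hull hdom hsharp q₀.2.1 q₀.2.2 (hqA q₀ hq₀.le)
    have hg0 : g ≠ ⊥ := fun h => q₀.2.2 (le_bot_iff.1 (h ▸ (hqA q₀ hq₀.le).trans hAg))
    let γ : principalSubmonoid hdom := ⟨g, hg, hg0⟩
    refine ⟨γ, le_antisymm ?_ ?_⟩
    · by_contra! hlt
      obtain ⟨q, hq1, hq2⟩ := btw r _ hr hlt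
      exact hq2.not_ge (hanti.antitone (show q ≤ γ from (hqA q hq1.le).trans hAg))
    · by_contra! hlt
      obtain ⟨q, hq1, hq2⟩ := btw _ r (fnn γ) hlt
      refine hq1.not_ge (hanti.antitone (show γ ≤ q from hmin q.1 q.2.1 (sSup_le ?_)))
      rintro _ ⟨s, rfl, hs⟩
      exact hle (hq2.le.trans hs)
  -- In the cyclic case an element whose value is the positive generator is the largest principal
  -- non-unit, hence equals μ. If there is no nonzero principal non-unit, then μ = 0, also
  -- principal.
  · refine absurd ?_ hp
    have haH : |a| ∈ H := by
      have : a ∈ H := ha ▸ AddSubgroup.mem_closure_singleton_self a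
      rcases abs_choice a with h | h <;> rw [h]
      · exact this
      · exact H.neg_mem this
    obtain ⟨p, hpa⟩ := hH _ haH (abs_nonneg a)
    have hq : ∀ q : principalSubmonoid hdom, q.1 ≠ 1 → 0 < |a| ∧ |a| ≤ f q := by
      intro q hq1
      have h1 := hfH q
      rw [ha, AddSubgroup.mem_closure_singleton] at h1
      obtain ⟨k, hk⟩ := h1
      have h2 := hpos q hq1
      have hk' : f q = |(k : ℝ)| * |a| := by
        rw [← abs_mul, ← zsmul_eq_mul, hk, abs_of_pos h2]
      have hk0 : k ≠ 0 := by
        rintro rfl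
        simp at hk
        exact h2.ne hk
      have hk1 : (1 : ℝ) ≤ |(k : ℝ)| := by exact_mod_cast Int.one_le_abs hk0
      have ha0 : 0 < |a| := by
        refine (abs_nonneg a).lt_of_ne fun h => h2.ne' ?_
        rw [hk', ← h, mul_zero]
      exact ⟨ha0, by rw [hk']; exact le_mul_of_one_le_left ha0.le hk1⟩
    by_cases hex : ∃ q : principalSubmonoid hdom, q.1 ≠ 1
    · obtain ⟨q, hq1⟩ := hex
      have hp1 : p.1 ≠ 1 := by
        intro h
        have h1 : p = 1 := Subtype.ext h
        rw [h1, f1] at hpa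
        exact (hq q hq1).1.ne hpa
      have : μ = p.1 := by
        refine le_antisymm (hgen.le_of_forall fun s hs hsμ => ?_) (hμ _ hp1)
        rcases eq_or_ne s ⊥ with rfl | hs0
        · exact bot_le
        have h1 : s ≠ 1 := fun h => hμ1 (le_antisymm (le_one _) (h ▸ hsμ))
        have h2 := (hq ⟨s, hs, hs0⟩ h1).2
        rw [← hpa] at h2
        exact hle h2
      exact this ▸ p.2.1
    · push Not at hex
      have : μ ≤ ⊥ := hgen.le_of_forall fun s hs hsμ => by
        by_contra hs0
        exact hμ1 (le_antisymm (le_one _) (hex ⟨s, hs, fun h => hs0 h.le⟩ ▸ hsμ))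
      exact le_bot_iff.1 this ▸ isPrincipal_bot

/-- The map sends x to the values of the nonzero principal elements below it, together with ∞. As
all r ≥ 0 are values, this set is an upper ray, or {∞} when x = 0. -/
theorem nonempty_orderMonoidIso_rOne {f : principalSubmonoid hdom → ℝ}
    (hf : ∀ p q, f (p * q) = f p + f q) (hanti : StrictAnti f)
    (hsurj : ∀ r : ℝ, 0 ≤ r → ∃ p, f p = r) : Nonempty (V ≃*o ROne) := by
  have tot := le_total_of_local hdom hgen hsharp hloc
  have hle : ∀ {p q}, f p ≤ f q → q ≤ p := by
    intro p q h
    refine (tot q.1 p.1).elim id fun h1 => ?_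
    rcases h1.eq_or_lt with h2 | h2
    · exact h2.ge
    · exact absurd (hanti (show p < q from h2)) h.not_gt
  have f1 : f 1 = 0 := by
    have := hf 1 1
    rw [mul_one] at this
    linarith
  have fnn : ∀ p, 0 ≤ f p := fun p => f1 ▸ hanti.antitone (le_one p.1)
  let φ : V → Set EReal := fun x =>
    insert ⊤ {a | ∃ p : principalSubmonoid hdom, p.1 ≤ x ∧ (f p : EReal) = a}
  have mtop : ∀ x, ⊤ ∈ φ x := fun x => Set.mem_insert _ _
  have mbot : ∀ x, ⊥ ∉ φ x := by
    rintro x (h | ⟨p, -, h⟩)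
    · exact bot_ne_top h
    · exact EReal.coe_ne_bot _ h
  have mcoe : ∀ x (r : ℝ), (r : EReal) ∈ φ x ↔ ∃ p : principalSubmonoid hdom, p.1 ≤ x ∧ f p = r := by
    intro x r
    constructor
    · rintro (h | ⟨p, hp, h⟩)
      · exact absurd h (EReal.coe_ne_top _)
      · exact ⟨p, hp, EReal.coe_eq_coe_iff.1 h⟩
    · rintro ⟨p, hp, rfl⟩
      exact Or.inr ⟨p, hp, rfl⟩
  have mmem : ∀ (p : principalSubmonoid hdom) x, (f p : EReal) ∈ φ x ↔ p.1 ≤ x := by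
    intro p x
    rw [mcoe]
    constructor
    · rintro ⟨q, hq, h⟩
      exact le_trans (show p.1 ≤ q.1 from hle h.le) hq
    · exact fun h => ⟨p, h, rfl⟩
  have ext : ∀ {A : Set EReal} {x : V}, ⊤ ∈ A → ⊥ ∉ A →
      (∀ r : ℝ, (r : EReal) ∈ φ x ↔ (r : EReal) ∈ A) → φ x = A := by
    intro A x h1 h2 h
    ext a
    induction a with
    | bot => exact iff_of_false (mbot x) h2
    | top => exact iff_of_true (mtop x) h1
    | coe r => exact h r
  have hint : ∀ x, IsRInterval (φ x) := by
    intro x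
    rcases eq_or_ne x ⊥ with rfl | hx
    · refine Or.inl (ext rfl bot_ne_top fun r => iff_of_false ?_ (EReal.coe_ne_top r))
      rw [mcoe]
      rintro ⟨p, hp, -⟩
      exact p.2.2 (le_bot_iff.1 hp)
    right
    let T : Set ℝ := {r | ∃ p : principalSubmonoid hdom, p.1 ≤ x ∧ f p = r}
    obtain ⟨b, hb, hbx, hb0⟩ := hgen.exists_principal (x := x) (y := ⊥)
      fun h => hx (le_bot_iff.1 h)
    have hT : T.Nonempty := ⟨_, ⟨b, hb, fun h => hb0 h.le⟩, hbx, rfl⟩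
    have hlb : ∀ t ∈ T, 0 ≤ t := by
      rintro _ ⟨p, -, rfl⟩
      exact fnn p
    have hbdd : BddBelow T := ⟨0, hlb⟩
    have hup : ∀ t ∈ T, ∀ s, t ≤ s → s ∈ T := by
      rintro _ ⟨p, hp, rfl⟩ s hs
      obtain ⟨q, rfl⟩ := hsurj s ((fnn p).trans hs)
      exact ⟨q, le_trans (show q.1 ≤ p.1 from hle hs) hp, rfl⟩
    refine ⟨sInf T, le_csInf hT hlb, ?_⟩
    by_cases hmem : sInf T ∈ T
    · refine Or.inl (ext (by simp) (by simp) fun r => ?_)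
      rw [mcoe, Set.mem_Icc, EReal.coe_le_coe_iff]
      exact ⟨fun h => ⟨csInf_le hbdd h, le_top⟩, fun h => hup _ hmem _ h.1⟩
    · refine Or.inr (ext (by simp) (by simp) fun r => ?_)
      rw [mcoe, Set.mem_Ioc, EReal.coe_lt_coe_iff]
      refine ⟨fun h => ⟨(csInf_le hbdd h).lt_of_ne fun h' => hmem (h' ▸ h), le_top⟩, fun h => ?_⟩
      obtain ⟨t, ht, htr⟩ := exists_lt_of_csInf_lt hT h.1
      exact hup t ht r htr.le
  refine nonempty_orderMonoidIso (fun x => (⟨φ x, hint x⟩ : ROne)) ?_ ?_ ?_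
  · intro x y
    change φ x ⊆ φ y ↔ x ≤ y
    refine ⟨fun h => hgen.le_of_forall fun p hp hpx => ?_, fun h => ?_⟩
    · rcases eq_or_ne p ⊥ with rfl | hp0
      · exact bot_le
      · exact (mmem ⟨p, hp, hp0⟩ y).1 (h ((mmem ⟨p, hp, hp0⟩ x).2 hpx))
    · rintro a (rfl | ⟨p, hp, rfl⟩)
      · exact mtop y
      · exact (mmem p y).2 (hp.trans h)
  · intro x y
    refine Subtype.ext ?_
    change φ (x * y) = φ x + φ y
    ext a
    rw [Set.mem_add]
    constructor
    · rintro (rfl | ⟨p, hp, rfl⟩)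
      · exact ⟨⊤, mtop x, ⊤, mtop y, rfl⟩
      obtain ⟨S, hS, rfl⟩ := hgen x
      rw [sSup_mul_distrib, ← sSup_image] at hp
      obtain ⟨_, ⟨s, hs, rfl⟩, hps⟩ := exists_le_of_le_sSup hdom hgen hsharp hloc p.2.1 p.2.2 hp
      obtain ⟨T, hT, rfl⟩ := hgen y
      change p.1 ≤ s * sSup T at hps
      rw [mul_sSup_distrib, ← sSup_image] at hps
      obtain ⟨_, ⟨t, ht, rfl⟩, hpt⟩ := exists_le_of_le_sSup hdom hgen hsharp hloc p.2.1 p.2.2 hps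
      have hs0 : s ≠ ⊥ := by
        rintro rfl
        exact p.2.2 (le_bot_iff.1 (by simpa using hpt))
      have ht0 : t ≠ ⊥ := by
        rintro rfl
        exact p.2.2 (le_bot_iff.1 (by simpa using hpt))
      let s' : principalSubmonoid hdom := ⟨s, hS s hs, hs0⟩
      let t' : principalSubmonoid hdom := ⟨t, hT t ht, ht0⟩
      obtain ⟨c, rfl⟩ := exists_mul_eq_of_le hdom (show p ≤ s' * t' from hpt)
      -- Here p = s t c with s ≤ x and t ≤ y, so its value splits as f(s) + f(t c).
      refine ⟨f s', (mmem _ _).2 (le_sSup hs), f (t' * c), (mmem _ _).2 ?_, ?_⟩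
      · exact (mul_le_left t c.1).trans (le_sSup ht)
      · rw [← EReal.coe_add, ← hf, mul_assoc]
    · rintro ⟨a, ha, b, hb, rfl⟩
      rcases ha with rfl | ⟨p, hp, rfl⟩
      · rw [EReal.top_add_of_ne_bot fun h => mbot y (h ▸ hb)]
        exact mtop _
      rcases hb with rfl | ⟨q, hq, rfl⟩
      · rw [EReal.add_top_of_ne_bot (EReal.coe_ne_bot _)]
        exact mtop _
      rw [← EReal.coe_add, ← hf, mmem]
      exact mul_le_mul' hp hq
  · rintro ⟨A, hA⟩
    suffices h : ∃ x, φ x = A from h.imp fun x hx => Subtype.ext hx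
    rcases hA with rfl | ⟨r, hr, rfl | rfl⟩
    · refine ⟨⊥, ext rfl bot_ne_top fun r => iff_of_false ?_ (EReal.coe_ne_top r)⟩
      rw [mcoe]
      rintro ⟨p, hp, -⟩
      exact p.2.2 (le_bot_iff.1 hp)
    · obtain ⟨p, rfl⟩ := hsurj r hr
      refine ⟨p.1, ext (by simp) (by simp) fun s => ?_⟩
      rw [mcoe, Set.mem_Icc, EReal.coe_le_coe_iff]
      constructor
      · rintro ⟨q, hq, rfl⟩
        exact ⟨hanti.antitone hq, le_top⟩
      · rintro ⟨h, -⟩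
        obtain ⟨q, rfl⟩ := hsurj s (hr.trans h)
        exact ⟨q, hle h, rfl⟩
    -- The open ray comes from a join that does not acquire the value r: a principal element below
    -- it lies below a single generator, of value > r.
    · refine ⟨sSup {x | ∃ p : principalSubmonoid hdom, p.1 = x ∧ r < f p},
        ext (by simp) (by simp) fun s => ?_⟩
      rw [mcoe, Set.mem_Ioc, EReal.coe_lt_coe_iff]
      constructor
      · rintro ⟨q, hq, rfl⟩
        obtain ⟨_, ⟨p, rfl, hp⟩, hqp⟩ :=
          exists_le_of_le_sSup hdom hgen hsharp hloc q.2.1 q.2.2 hq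
        exact ⟨hp.trans_le (hanti.antitone hqp), le_top⟩
      · rintro ⟨h, -⟩
        obtain ⟨q, rfl⟩ := hsurj s (hr.trans h.le)
        exact ⟨q, le_sSup ⟨q, rfl, h⟩, rfl⟩

/-- A sharp local lattice domain generated by principal elements is `ℤ₋` or `ℝ₁`. -/
theorem nonempty_orderMonoidIso_of_local (hne : ∃ x : V, x ≠ ⊥ ∧ x ≠ ⊤) :
    Nonempty (V ≃*o ZMinus) ∨ Nonempty (V ≃*o ROne) := by
  obtain ⟨μ, hμ1, hμ⟩ := exists_maximal hloc
  by_cases hp : IsPrincipal μ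
  · left
    obtain ⟨x, hx0, hx1⟩ := hne
    refine nonempty_orderMonoidIso_zMinus hdom hgen hsharp hloc hμ1 hμ hp fun h => hx0 ?_
    rw [← one_eq_top] at hx1
    exact le_bot_iff.1 (h ▸ hμ x hx1)
  · right
    obtain ⟨f, hf, hanti⟩ := exists_valuation hdom hgen hsharp hloc
    exact nonempty_orderMonoidIso_rOne hdom hgen hsharp hloc hf hanti fun r hr =>
      valuation_surjective hdom hgen hsharp hloc hμ1 hμ hp hf hanti hr

end Valuation

/-! ### Nonzero primes are maximal; the dimension -/

section Global

variable {L : Type*} [CompleteLattice L] [CommMonoid L] [MultiplicativeLattice L]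
  (hC : IsCLattice L) (hdom : IsLatticeDomain L) (hgen : IsPrincipallyGenerated L)
  (hsharp : IsSharp L)
include hC hdom hgen hsharp

/-- For m maximal above p and b ≤ m principal, the archimedean property in L_m gives bⁿ ≤ p_m.
Clearing denominators, bⁿ s ≤ p with s ≰ m, so primality puts b below p. -/
theorem isCoatom_of_isPrimeElement {p : L} (hp : IsPrimeElement p) (h0 : p ≠ ⊥) : IsCoatom p := by
  have : IsCoatomic L := CompleteLattice.coatomic_of_top_compact
    (one_eq_top (L := L) ▸ hC.isCompact_one)
  obtain ⟨m, hm, hpm⟩ := (eq_top_or_exists_le_coatom p).resolve_left hp.1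
  suffices h : m ≤ p by rwa [le_antisymm hpm h]
  refine hgen.le_of_forall fun b hb hbm => ?_
  let := locCompleteLattice hC hm
  let := locCommMonoid hC hm
  have := locMultiplicativeLattice hC hm
  have hb1 : toLoc m b ≠ 1 := by
    intro h
    have h1 : toLoc m ⊤ ≤ toLoc m m :=
      (le_one (toLoc m ⊤)).trans (h.ge.trans (loc_mono m hbm))
    exact hm.1 (top_le_iff.1 ((le_loc hC hm ⊤).trans
      (le_trans (show loc m ⊤ ≤ loc m m from h1) (loc_self hC hm).le)))
  have hp0 : toLoc m p ≠ ⊥ := by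
    intro h
    have h1 : toLoc m p ≤ toLoc m ⊥ := h.le.trans bot_le
    exact h0 (le_bot_iff.1 ((le_loc hC hm p).trans
      (le_trans (show loc m p ≤ loc m ⊥ from h1) (loc_bot hdom).le)))
  obtain ⟨n, hn⟩ := exists_pow_le (isLatticeDomain_localizationAt hC hm hdom)
    (isPrincipallyGenerated_localizationAt hC hm hdom hgen) (isSharp_localizationAt hC hm hsharp)
    (one_mem_of_sSup_eq_one_localizationAt hC hm) (isPrincipal_toLoc hC hm hdom hb) hb1 hp0
  have hpow : toLoc m (b ^ n) = toLoc m b ^ n := map_pow (toLocHom hC hm) b n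
  have hbn : IsCompactElement (b ^ n) := by
    clear hn hpow
    induction n with
    | zero => simpa using hC.isCompact_one
    | succ n ih =>
      rw [pow_succ]
      exact hC.isCompact_mul _ _ ih (hb.isCompactElement hdom hC)
  have h2 : b ^ n ≤ loc m p := (le_loc hC hm _).trans (show toLoc m (b ^ n) ≤ toLoc m p from
    hpow.le.trans hn)
  obtain ⟨s, -, hsm, hs⟩ := (le_loc_iff hC hm hbn).1 h2
  exact hp.le_of_pow_le ((hp.2 _ _ hs).resolve_right fun h => hsm (h.trans hpm))

omit [CommMonoid L] [MultiplicativeLattice L] hC hdom hgen hsharp in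
theorem ne_bot_of_isCoatom (hne : ∃ x : L, x ≠ ⊥ ∧ x ≠ ⊤) {m : L} (hm : IsCoatom m) : m ≠ ⊥ := by
  rintro rfl
  obtain ⟨x, hx0, hx1⟩ := hne
  exact hx1 (hm.2 x (bot_lt_iff_ne_bot.2 hx0))

theorem dimension_eq_one (hne : ∃ x : L, x ≠ ⊥ ∧ x ≠ ⊤) : dimension L = 1 := by
  refine le_antisymm (Order.krullDim_le_one_iff.2 fun p => ?_) (Order.one_le_krullDim_iff.2 ?_)
  · rcases eq_or_ne p.1 ⊥ with h | h
    · exact Or.inl fun q _ => show p.1 ≤ q.1 from h ▸ bot_le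
    · refine Or.inr fun q hpq => ?_
      have hm := isCoatom_of_isPrimeElement hC hdom hgen hsharp p.2 h
      exact ((hm.le_iff_eq q.2.1).1 hpq).le
  · have : IsCoatomic L := CompleteLattice.coatomic_of_top_compact
      (one_eq_top (L := L) ▸ hC.isCompact_one)
    obtain ⟨m, hm, -⟩ := (eq_top_or_exists_le_coatom (⊥ : L)).resolve_left hdom.1
    exact ⟨⟨⊥, hdom⟩, ⟨m, isPrime_of_isCoatom hm⟩, bot_lt_iff_ne_bot.2 (ne_bot_of_isCoatom hne hm)⟩

end Global

end MultiplicativeLattice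

theorem theorem3 (L : Type*) [CompleteLattice L] [CommMonoid L] [MultiplicativeLattice L]
    (hC : MultiplicativeLattice.IsCLattice L)
    (hdom : MultiplicativeLattice.IsLatticeDomain L)
    (hgen : MultiplicativeLattice.IsPrincipallyGenerated L)
    (hne : ∃ x : L, x ≠ ⊥ ∧ x ≠ ⊤)
    (hsharp : MultiplicativeLattice.IsSharp L) :
    (∀ m : L, IsCoatom m →
      Nonempty (MultiplicativeLattice.LocalizationAt m ≃*o MultiplicativeLattice.ZMinus) ∨
      Nonempty (MultiplicativeLattice.LocalizationAt m ≃*o MultiplicativeLattice.ROne)) ∧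
    MultiplicativeLattice.IsPruefer L ∧
    MultiplicativeLattice.dimension L = 1 := by
  open MultiplicativeLattice in
  refine ⟨fun m hm => ?_, isPruefer hdom hsharp hgen, dimension_eq_one hC hdom hgen hsharp hne⟩
  let := locCompleteLattice hC hm
  let := locCommMonoid hC hm
  have := locMultiplicativeLattice hC hm
  exact nonempty_orderMonoidIso_of_local (isLatticeDomain_localizationAt hC hm hdom)
    (isPrincipallyGenerated_localizationAt hC hm hdom hgen) (isSharp_localizationAt hC hm hsharp)
    (one_mem_of_sSup_eq_one_localizationAt hC hm)
    (exists_ne_localizationAt hC hm hdom (ne_bot_of_isCoatom hne hm))
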